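/- Let $k$ be a field, $H$ a Hopf algebra over $k$ with antipode $S$, and $C$ a right $H$-module coalgebra (a coalgebra and right $H$-module with $\Delta(ch)=c_1h_1\otimes c_2h_2$ and $\varepsilon(ch)=\varepsilon(c)\varepsilon(h)$). Let $I=\operatorname{span}\{ch-\varepsilon(h)c : c\in C,\ h\in H\}$, a two-sided coideal, $D=C/I$ the quotient coalgebra and $\pi\colon C\to D$ the projection. Let $C\,\square_D\,C\subseteq C\otimes C$ be the cotensor product, i.e. the subspace on which the maps $c\otimes c'\mapsto c_1\otimes\pi(c_2)\otimes c'$ and $c\otimes c'\mapsto c\otimes\pi(c'_1)\otimes c'_2$ agree. Assume that $C(D)_H$ is a Hopf Galois coextension, i.e. that the canonical map $$can\colon C\otimes H\to C\,\square_D\,C,\qquad c\otimes h\mapsto c_1\otimes c_2h,$$ is bijective, and that it is cleft by the total cointegral $f$: $f\colon C\to H$ is a linear map with $\varepsilon(f(c))=\varepsilon(c)$ and $f(ch)=f(c)h$, and $f$ has a two-sided inverse $f^{-1}\colon C\to H$ for the convolution product, i.e. $f(c_1)f^{-1}(c_2)=\varepsilon(c)1_H=f^{-1}(c_1)f(c_2)$.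 Put $$C^D=\{c\in C : c_1\,\varphi(\pi(c_2))=c_2\,\varphi(\pi(c_1))\ \text{ for all }\varphi\in D^*\},$$ where $D^*$ is the algebraic dual of $D$. Then $C^D$ is an $H$-submodule of $C$, the formula $$\rho(c)=f^{-1}(c_3)\,f(c_1)\otimes c_2$$ defines a linear map $\rho\colon C^D\to H\otimes C^D$, and with the restricted action and the coaction $\rho$ the space $C^D$ is a right-left stable anti-Yetter–Drinfeld module over $H$. That is, writing $\rho(m)=m_{(-1)}\otimes m_{(0)}$: $\rho$ is a coassociative and counital left coaction, $\rho(mh)=S(h_3)\,m_{(-1)}\,h_1\otimes m_{(0)}h_2$, and $m_{(0)}m_{(-1)}=m$, for all $m\in C^D$ and $h\in H$. -/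

import Mathlib

open scoped TensorProduct RightActions

namespace HopfCoextension

section Action

variable (k H M : Type*) [Field k] [Ring H] [HopfAlgebra k H] [AddCommGroup M] [Module k M]
  [Module Hᵐᵒᵖ M] [IsScalarTower k Hᵐᵒᵖ M]

/-- A right `H`-module over `k` is a module over the opposite algebra of `H` whose scalars are
compatible with those of `k`; this is its action map `M ⊗ H → M`, `m ⊗ h ↦ m h`. -/
noncomputable def rightAct : M ⊗[k] H →ₗ[k] M :=
  TensorProduct.lift <| LinearMap.mk₂ k (fun (m : M) (h : H) => m <• h)
    (fun m n h => smul_add _ m n)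
    (fun r m h => smul_comm (MulOpposite.op h) r m)
    (fun m h h' => by rw [MulOpposite.op_add, add_smul])
    (fun r m h => by rw [MulOpposite.op_smul, smul_assoc])

@[simp] lemma rightAct_tmul (m : M) (h : H) : rightAct k H M (m ⊗ₜ h) = m <• h := rfl

/-- The map `H ⊗ (H ⊗ H) → H`, `a ⊗ (x ⊗ z) ↦ S(z) a x`, where `S` is the antipode. -/
noncomputable def antipodeSandwich : H ⊗[k] (H ⊗[k] H) →ₗ[k] H :=
  LinearMap.mul' k H
    ∘ₗ TensorProduct.map (HopfAlgebra.antipode k) (LinearMap.mul' k H)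
    ∘ₗ (TensorProduct.comm k (H ⊗[k] H) H).toLinearMap
    ∘ₗ (TensorProduct.assoc k H H H).symm.toLinearMap

@[simp] lemma antipodeSandwich_tmul (a x z : H) :
    antipodeSandwich k H (a ⊗ₜ (x ⊗ₜ z)) = HopfAlgebra.antipode k z * (a * x) := rfl

/-- The map `(H ⊗ M) ⊗ (H ⊗ (H ⊗ H)) → H ⊗ M`,
`(a ⊗ m) ⊗ (x ⊗ (y ⊗ z)) ↦ S(z) a x ⊗ m y`. -/
noncomputable def aydTwist : (H ⊗[k] M) ⊗[k] (H ⊗[k] (H ⊗[k] H)) →ₗ[k] H ⊗[k] M :=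
  TensorProduct.map (antipodeSandwich k H) (rightAct k H M)
    ∘ₗ (TensorProduct.tensorTensorTensorComm k H M (H ⊗[k] H) H).toLinearMap
    ∘ₗ LinearMap.lTensor (H ⊗[k] M)
        ((TensorProduct.rightComm k H H H).toLinearMap
          ∘ₗ (TensorProduct.assoc k H H H).symm.toLinearMap)

@[simp] lemma aydTwist_tmul (a x y z : H) (m : M) :
    aydTwist k H M ((a ⊗ₜ m) ⊗ₜ (x ⊗ₜ (y ⊗ₜ z))) =
      (HopfAlgebra.antipode k z * (a * x)) ⊗ₜ (m <• y) := rfl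

variable {k H M}

/-- `ρ : M → H ⊗ M`, written `ρ m = m₍₋₁₎ ⊗ m₍₀₎`, makes the right `H`-module `M` a right-left
stable anti-Yetter-Drinfeld module over `H`. -/
structure IsRightLeftSAYD (ρ : M →ₗ[k] H ⊗[k] M) : Prop where
  /-- `ρ` is coassociative. -/
  coassoc : (TensorProduct.assoc k H H M).toLinearMap ∘ₗ LinearMap.rTensor M Coalgebra.comul ∘ₗ ρ
    = LinearMap.lTensor H ρ ∘ₗ ρ
  /-- `ρ` is counital: `ε(m₍₋₁₎) m₍₀₎ = m`. -/
  counit_coact : ∀ m : M,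
    TensorProduct.lid k M (LinearMap.rTensor M Coalgebra.counit (ρ m)) = m
  /-- `ρ (m h) = S(h₃) m₍₋₁₎ h₁ ⊗ m₍₀₎ h₂`. -/
  antiYetterDrinfeld : ∀ (m : M) (h : H), ρ (m <• h) =
    aydTwist k H M (ρ m ⊗ₜ LinearMap.lTensor H Coalgebra.comul (Coalgebra.comul (R := k) h))
  /-- `m₍₀₎ m₍₋₁₎ = m`. -/
  stable : ∀ m : M, rightAct k H M (TensorProduct.comm k H M (ρ m)) = m

end Action

section Coextension

variable (k H C : Type*) [Field k] [Ring H] [HopfAlgebra k H] [AddCommGroup C] [Module k C]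
  [Coalgebra k C] [Module Hᵐᵒᵖ C] [IsScalarTower k Hᵐᵒᵖ C]

/-- The coalgebra and right `H`-module `C` is a right `H`-module coalgebra:
`Δ(c h) = c₁ h₁ ⊗ c₂ h₂` and `ε(c h) = ε(c) ε(h)`. -/
class IsModuleCoalgebra : Prop where
  comul_act : ∀ (c : C) (h : H), Coalgebra.comul (R := k) (c <• h) =
    TensorProduct.map (rightAct k H C) (rightAct k H C)
      (TensorProduct.tensorTensorTensorComm k C C H H
        (Coalgebra.comul (R := k) c ⊗ₜ Coalgebra.comul (R := k) h))
  counit_act : ∀ (c : C) (h : H), Coalgebra.counit (R := k) (c <• h) =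
    Coalgebra.counit (R := k) c * Coalgebra.counit (R := k) h

/-- The coideal `I = span {c h - ε(h) c}` of `C`. -/
def coideal : Submodule k C :=
  Submodule.span k {x | ∃ (c : C) (h : H), x = c <• h - Coalgebra.counit (R := k) h • c}

/-- The quotient `D = C / I`. -/
abbrev base : Type _ := C ⧸ coideal k H C

/-- The projection `π : C → D`. -/
abbrev proj : C →ₗ[k] base k H C := (coideal k H C).mkQ

lemma proj_act (c : C) (h : H) :
    proj k H C (c <• h) = Coalgebra.counit (R := k) h • proj k H C c := by
  rw [← map_smul, ← sub_eq_zero, ← map_sub]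
  exact (Submodule.Quotient.mk_eq_zero _).2 (Submodule.subset_span ⟨c, h, rfl⟩)

lemma proj_comp_rightAct : proj k H C ∘ₗ rightAct k H C =
    (TensorProduct.rid k (base k H C)).toLinearMap
      ∘ₗ TensorProduct.map (proj k H C) Coalgebra.counit := by
  ext c h
  simp [-Submodule.mkQ_apply, proj_act]

/-- `I` is a two-sided coideal, so `D` is a coalgebra and `π` a map of coalgebras. -/
instance [IsModuleCoalgebra k H C] : (coideal k H C).IsCoideal where
  counit_eq_zero := by
    intro x hx
    induction hx using Submodule.span_induction with
    | mem x h =>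
      obtain ⟨c, h, rfl⟩ := h
      simp [IsModuleCoalgebra.counit_act, mul_comm]
    | zero => simp
    | add x y _ _ hx hy => simp [hx, hy]
    | smul a x _ hx => simp [hx]
  map_mkQ_comul_eq_zero := by
    intro x hx
    induction hx using Submodule.span_induction with
    | mem x h =>
      obtain ⟨c, h, rfl⟩ := h
      rw [map_sub, IsModuleCoalgebra.comul_act, map_smul, map_sub, map_smul, sub_eq_zero]
      rw [← LinearMap.comp_apply, ← TensorProduct.map_comp, proj_comp_rightAct]
      have key : ∀ (u : C ⊗[k] C) (v : H ⊗[k] H),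
          TensorProduct.map
            ((TensorProduct.rid k (base k H C)).toLinearMap
              ∘ₗ TensorProduct.map (proj k H C) Coalgebra.counit)
            ((TensorProduct.rid k (base k H C)).toLinearMap
              ∘ₗ TensorProduct.map (proj k H C) Coalgebra.counit)
            (TensorProduct.tensorTensorTensorComm k C C H H (u ⊗ₜ v)) =
          (Coalgebra.counit (R := k)
            (TensorProduct.lid k H (LinearMap.rTensor H Coalgebra.counit v))) •
            TensorProduct.map (proj k H C) (proj k H C) u := by
        intro u v
        induction u with
        | zero => simp
        | add a b ha hb => rw [TensorProduct.add_tmul, map_add, map_add, ha, hb, map_add, smul_add]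
        | tmul a b =>
          induction v with
          | zero => simp
          | add x y hx hy =>
            rw [TensorProduct.tmul_add, map_add, map_add, hx, hy]
            simp only [map_add, add_smul]
          | tmul x y =>
            simp [TensorProduct.smul_tmul', TensorProduct.tmul_smul, smul_smul, mul_comm]
      rw [key]
      simp
    | zero => simp
    | add x y _ _ hx hy => simp only [map_add, hx, hy, add_zero]
    | smul a x _ hx => simp only [map_smul, hx, smul_zero]

/-- The cotensor product `C □_D C`: the tensors on which `c ⊗ c' ↦ c₁ ⊗ π(c₂) ⊗ c'` and
`c ⊗ c' ↦ c ⊗ π(c'₁) ⊗ c'₂` agree. -/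
noncomputable def cotensor : Submodule k (C ⊗[k] C) :=
  LinearMap.eqLocus
    ((TensorProduct.assoc k C (base k H C) C).toLinearMap
      ∘ₗ LinearMap.rTensor C (LinearMap.lTensor C (proj k H C) ∘ₗ Coalgebra.comul))
    (LinearMap.lTensor C (LinearMap.rTensor C (proj k H C) ∘ₗ Coalgebra.comul))

/-- The map `C ⊗ H → C ⊗ C`, `c ⊗ h ↦ c₁ ⊗ c₂ h`. -/
noncomputable def canAux : C ⊗[k] H →ₗ[k] C ⊗[k] C :=
  LinearMap.lTensor C (rightAct k H C)
    ∘ₗ (TensorProduct.assoc k C C H).toLinearMap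
    ∘ₗ LinearMap.rTensor H Coalgebra.comul

lemma canAux_mem [IsModuleCoalgebra k H C] (x : C ⊗[k] H) :
    canAux k H C x ∈ cotensor k H C := by
  have h1 : ∀ (c : C) (h : H),
      LinearMap.rTensor C (proj k H C) (Coalgebra.comul (R := k) (c <• h)) =
      LinearMap.lTensor (base k H C) (rightAct k H C)
        (TensorProduct.assoc k (base k H C) C H
          (LinearMap.rTensor C (proj k H C) (Coalgebra.comul (R := k) c) ⊗ₜ h)) := by
    intro c h
    have key : ∀ (u : C ⊗[k] C) (v : H ⊗[k] H),
        LinearMap.rTensor C (proj k H C)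
          (TensorProduct.map (rightAct k H C) (rightAct k H C)
            (TensorProduct.tensorTensorTensorComm k C C H H (u ⊗ₜ v))) =
        LinearMap.lTensor (base k H C) (rightAct k H C)
          (TensorProduct.assoc k (base k H C) C H
            (LinearMap.rTensor C (proj k H C) u ⊗ₜ
              TensorProduct.lid k H (LinearMap.rTensor H Coalgebra.counit v))) := by
      intro u v
      induction u with
      | zero => simp
      | add a b ha hb => simp only [TensorProduct.add_tmul, map_add, ha, hb]
      | tmul a b =>
        induction v with
        | zero => simp
        | add x y hx hy => simp only [TensorProduct.tmul_add, map_add, hx, hy]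
        | tmul x y =>
          simp [-Submodule.mkQ_apply, proj_act, TensorProduct.smul_tmul', TensorProduct.tmul_smul]
    rw [IsModuleCoalgebra.comul_act, key]
    simp
  have h2 : ∀ (u : C ⊗[k] C) (h : H),
      TensorProduct.assoc k C (base k H C) C
        (LinearMap.rTensor C (LinearMap.lTensor C (proj k H C) ∘ₗ Coalgebra.comul)
          (LinearMap.lTensor C (rightAct k H C) (TensorProduct.assoc k C C H (u ⊗ₜ h)))) =
      LinearMap.lTensor C (LinearMap.lTensor (base k H C) (rightAct k H C)
          ∘ₗ (TensorProduct.assoc k (base k H C) C H).toLinearMap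
          ∘ₗ (TensorProduct.mk k (base k H C ⊗[k] C) H).flip h
          ∘ₗ LinearMap.rTensor C (proj k H C))
        (TensorProduct.assoc k C C C (LinearMap.rTensor C Coalgebra.comul u)) := by
    intro u h
    induction u with
    | zero => simp
    | add a b ha hb => simp only [TensorProduct.add_tmul, map_add, ha, hb]
    | tmul a b =>
      simp only [TensorProduct.assoc_tmul, LinearMap.lTensor_tmul, rightAct_tmul,
        LinearMap.rTensor_tmul, LinearMap.comp_apply]
      induction (Coalgebra.comul (R := k) a) with
      | zero => simp
      | add x y hx hy => simp only [TensorProduct.add_tmul, map_add, hx, hy]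
      | tmul x y => simp
  have h3 : ∀ (u : C ⊗[k] C) (h : H),
      LinearMap.lTensor C (LinearMap.rTensor C (proj k H C) ∘ₗ Coalgebra.comul)
          (LinearMap.lTensor C (rightAct k H C) (TensorProduct.assoc k C C H (u ⊗ₜ h))) =
      LinearMap.lTensor C (LinearMap.lTensor (base k H C) (rightAct k H C)
          ∘ₗ (TensorProduct.assoc k (base k H C) C H).toLinearMap
          ∘ₗ (TensorProduct.mk k (base k H C ⊗[k] C) H).flip h
          ∘ₗ LinearMap.rTensor C (proj k H C))
        (LinearMap.lTensor C Coalgebra.comul u) := by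
    intro u h
    induction u with
    | zero => simp
    | add a b ha hb => simp only [TensorProduct.add_tmul, map_add, ha, hb]
    | tmul a b => simp [-Submodule.mkQ_apply, h1]
  induction x with
  | zero => simp
  | add a b ha hb => rw [map_add]; exact add_mem ha hb
  | tmul c h =>
    change TensorProduct.assoc k C (base k H C) C
        (LinearMap.rTensor C (LinearMap.lTensor C (proj k H C) ∘ₗ Coalgebra.comul)
          (LinearMap.lTensor C (rightAct k H C)
            (TensorProduct.assoc k C C H (Coalgebra.comul (R := k) c ⊗ₜ h)))) =
      LinearMap.lTensor C (LinearMap.rTensor C (proj k H C) ∘ₗ Coalgebra.comul)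
          (LinearMap.lTensor C (rightAct k H C)
            (TensorProduct.assoc k C C H (Coalgebra.comul (R := k) c ⊗ₜ h)))
    rw [h2, h3, Coalgebra.coassoc_apply]

/-- The canonical map `can : C ⊗ H → C □_D C`, `c ⊗ h ↦ c₁ ⊗ c₂ h`. -/
noncomputable def can [IsModuleCoalgebra k H C] : C ⊗[k] H →ₗ[k] cotensor k H C :=
  (canAux k H C).codRestrict (cotensor k H C) (canAux_mem k H C)

/-- `C(D)_H` is a Hopf Galois coextension. -/
def IsHopfGalois [IsModuleCoalgebra k H C] : Prop := Function.Bijective (can k H C)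

/-- `C^D = {c | c₁ φ(π(c₂)) = c₂ φ(π(c₁)) for all φ in the dual space of D}`. -/
noncomputable def coextensionCenter : Submodule k C :=
  ⨅ φ : Module.Dual k (base k H C), LinearMap.eqLocus
    ((TensorProduct.rid k C).toLinearMap
      ∘ₗ LinearMap.lTensor C (φ ∘ₗ proj k H C) ∘ₗ Coalgebra.comul)
    ((TensorProduct.lid k C).toLinearMap
      ∘ₗ LinearMap.rTensor C (φ ∘ₗ proj k H C) ∘ₗ Coalgebra.comul)

variable {k H C}

/-- A total cointegral is a counital map of right `H`-modules `C → H`. -/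
structure IsTotalCointegral (f : C →ₗ[k] H) : Prop where
  counit_map : ∀ c : C, Coalgebra.counit (R := k) (f c) = Coalgebra.counit (R := k) c
  map_act : ∀ (c : C) (h : H), f (c <• h) = f c * h

/-- `g` is the (two-sided) inverse of `f` for the convolution product
`(f * g)(c) = f(c₁) g(c₂)`, whose unit is `c ↦ ε(c) 1`. -/
def IsConvInverse (f g : C →ₗ[k] H) : Prop :=
  WithConv.toConv f * WithConv.toConv g = 1 ∧ WithConv.toConv g * WithConv.toConv f = 1

/-- The map `C → H ⊗ C`, `c ↦ g(c₃) f(c₁) ⊗ c₂`. -/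
noncomputable def cleftCoaction (f g : C →ₗ[k] H) : C →ₗ[k] H ⊗[k] C :=
  LinearMap.rTensor C (LinearMap.mul' k H)
    ∘ₗ (TensorProduct.comm k C (H ⊗[k] H)).toLinearMap
    ∘ₗ (TensorProduct.assoc k C H H).toLinearMap
    ∘ₗ (TensorProduct.comm k H (C ⊗[k] H)).toLinearMap
    ∘ₗ TensorProduct.map f (LinearMap.lTensor C g)
    ∘ₗ LinearMap.lTensor C Coalgebra.comul
    ∘ₗ Coalgebra.comul

end Coextension

end HopfCoextension

/-!
Put `β(h ⊗ c) = c₁ ⊗ c₂ h`, the canonical map with its arguments swapped. Since `f` is right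
`H`-linear and convolution invertible, `β` is injective, with left inverse
`c ⊗ c' ↦ f⁻¹(c₂) f(c') ⊗ c₁`. Uniqueness of convolution inverses in `Hom(C ⊗ H, H)` gives
`f⁻¹(c h) = S(h) f⁻¹(c)`, which is what makes `π(c) ↦ c₁ f⁻¹(c₂)` a well-defined map `D → C`.
Applying that map to the equation `c₁ ⊗ π(c₂) = c₂ ⊗ π(c₁)`, which characterizes `C^D`, shows that
`β(f⁻¹(c₃) f(c₁) ⊗ c₂) = c₂ ⊗ c₁` for `c ∈ C^D`. As `β` is injective, this identity determines `ρ`,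
and it turns coassociativity, counitality and stability of `ρ` into the coalgebra axioms of `C`.
-/

namespace HopfCoextension

open Coalgebra TensorProduct MulOpposite WithConv
open HopfAlgebra (antipode)

section Coalgebra

variable {R A : Type*} [CommSemiring R] [AddCommMonoid A] [Module R A]

theorem eq_of_forall_dual_lTensor {M : Type*} [AddCommMonoid M] [Module R M] [Module.Free R A]
    {u v : M ⊗[R] A}
    (h : ∀ φ : Module.Dual R A, LinearMap.lTensor M φ u = LinearMap.lTensor M φ v) : u = v := by
  classical
  let b := Module.Free.chooseBasis R A
  have coord (i) : Finsupp.lapply i ∘ₗ (equivFinsuppOfBasisRight (M := M) b).toLinearMap =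
      (TensorProduct.rid R M).toLinearMap ∘ₗ LinearMap.lTensor M (b.coord i) := by
    ext; simp
  refine (equivFinsuppOfBasisRight b).injective (Finsupp.ext fun i => ?_)
  calc
    _ = TensorProduct.rid R M (LinearMap.lTensor M (b.coord i) u) := LinearMap.congr_fun (coord i) u
    _ = TensorProduct.rid R M (LinearMap.lTensor M (b.coord i) v) := by rw [h]
    _ = _ := (LinearMap.congr_fun (coord i) v).symm

variable [Coalgebra R A]

theorem comul_eq_sum (a : A) :
    comul (R := R) a = ∑ i ∈ (ℛ R a).index, (ℛ R a).left i ⊗ₜ (ℛ R a).right i :=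
  (ℛ R a).eq.symm

theorem sum_counit_smul_left {ι : Type*} {a : A} (r : Repr R a ι) :
    ∑ i ∈ r.index, counit (R := R) (r.right i) • r.left i = a := by
  simpa only [map_sum, _root_.TensorProduct.rid_tmul, one_smul] using
    congr(TensorProduct.rid R A $(sum_tmul_counit_eq r))

variable (R A) in
/-- The co-opposite comultiplication `a ↦ a₂ ⊗ a₁`. -/
noncomputable def comulSwap : A →ₗ[R] A ⊗[R] A :=
  (TensorProduct.comm R A A).toLinearMap ∘ₗ comul

end Coalgebra

variable {k H C : Type*} [Field k] [Ring H] [HopfAlgebra k H] [AddCommGroup C] [Module k C]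

theorem IsConvInverse.inv_mul_comul [Coalgebra k C] {f g : C →ₗ[k] H} (hfg : IsConvInverse f g)
    (c : C) : LinearMap.mul' k H (TensorProduct.map g f (comul c)) = counit (R := k) c • 1 := by
  rw [← Algebra.algebraMap_eq_smul_one, ← LinearMap.convOne_apply, ← hfg.2]
  rfl

variable [Module Hᵐᵒᵖ C]

theorem mem_coextensionCenter_iff [Coalgebra k C] {c : C} :
    c ∈ coextensionCenter k H C ↔
      LinearMap.lTensor C (proj k H C) (comul (R := k) c) =
        LinearMap.lTensor C (proj k H C) (comulSwap k C c) := by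
  have flip (φ : Module.Dual k (base k H C)) :
      (TensorProduct.lid k C).toLinearMap ∘ₗ LinearMap.rTensor C (φ ∘ₗ proj k H C) ∘ₗ comul =
        (TensorProduct.rid k C).toLinearMap ∘ₗ LinearMap.lTensor C (φ ∘ₗ proj k H C)
          ∘ₗ comulSwap k C := by
    ext c
    simp [comulSwap, comul_eq_sum]
  simp only [coextensionCenter, Submodule.mem_iInf, LinearMap.mem_eqLocus, flip,
    LinearMap.lTensor_comp, LinearMap.comp_apply, LinearEquiv.coe_coe,
    EmbeddingLike.apply_eq_iff_eq]
  exact ⟨eq_of_forall_dual_lTensor, fun h φ => by rw [h]⟩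

variable [IsScalarTower k Hᵐᵒᵖ C]

variable (k C) in
/-- The action `c ↦ c h` of a fixed `h : H`, as a `k`-linear endomorphism of `C`. -/
noncomputable def actBy (h : H) : C →ₗ[k] C := Algebra.lsmul k k C (op h)

@[simp]
theorem actBy_apply (h : H) (c : C) : actBy k C h c = c <• h := rfl

/-- The map `a ⊗ (b ⊗ c) ↦ b ⊗ c f(a)`, through which `c ↦ β(f⁻¹(c₃) f(c₁) ⊗ c₂)` factors. -/
noncomputable def actMiddle (f : C →ₗ[k] H) : C ⊗[k] (C ⊗[k] C) →ₗ[k] C ⊗[k] C :=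
  LinearMap.lTensor C
      (rightAct k H C ∘ₗ LinearMap.lTensor C f ∘ₗ (TensorProduct.comm k C C).toLinearMap)
    ∘ₗ (TensorProduct.leftComm k C C C).toLinearMap

@[simp]
theorem actMiddle_tmul (f : C →ₗ[k] H) (a b c : C) :
    actMiddle f (a ⊗ₜ (b ⊗ₜ c)) = b ⊗ₜ[k] (c <• f a) := rfl

variable [Coalgebra k C] {f g : C →ₗ[k] H}

section CanSwap

variable (k H C) in
/-- The map `β : H ⊗ C → C ⊗ C`, `h ⊗ c ↦ c₁ ⊗ c₂ h`: the canonical map precomposed with the flip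
and viewed as taking values in `C ⊗ C`. -/
noncomputable def canSwap : H ⊗[k] C →ₗ[k] C ⊗[k] C :=
  canAux k H C ∘ₗ (TensorProduct.comm k H C).toLinearMap

theorem canSwap_tmul (h : H) (c : C) :
    canSwap k H C (h ⊗ₜ c) = LinearMap.lTensor C (actBy k C h) (comul c) := by
  simp [canSwap, canAux, comul_eq_sum, sum_tmul]

theorem canSwap_injective (hf : ∀ (c : C) (h : H), f (c <• h) = f c * h)
    (hfg : IsConvInverse f g) : Function.Injective (canSwap k H C) := by
  let retraction : C ⊗[k] C →ₗ[k] H ⊗[k] C :=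
    (TensorProduct.comm k C H).toLinearMap
      ∘ₗ LinearMap.lTensor C (LinearMap.mul' k H ∘ₗ TensorProduct.map g f)
      ∘ₗ (TensorProduct.assoc k C C C).toLinearMap ∘ₗ LinearMap.rTensor C comul
  suffices retraction ∘ₗ canSwap k H C = LinearMap.id from
    Function.LeftInverse.injective (g := retraction) (LinearMap.congr_fun this)
  ext h c
  let F : C ⊗[k] (C ⊗[k] C) →ₗ[k] H ⊗[k] C := (TensorProduct.comm k C H).toLinearMap
    ∘ₗ LinearMap.lTensor C (LinearMap.mulRight k h ∘ₗ LinearMap.mul' k H ∘ₗ TensorProduct.map g f)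
  calc
    retraction (canSwap k H C (h ⊗ₜ c)) =
        F (TensorProduct.assoc k C C C (LinearMap.rTensor C comul (comul c))) := by
      simp [retraction, F, canSwap_tmul, comul_eq_sum, sum_tmul, hf, mul_assoc]
    _ = F (LinearMap.lTensor C comul (comul c)) := by rw [coassoc_apply]
    _ = h ⊗ₜ c := by
      simp [F, comul_eq_sum c, hfg.inv_mul_comul, ← smul_tmul', ← tmul_smul, ← tmul_sum,
        sum_counit_smul_left]

theorem lid_rTensor_counit_canSwap (x : H ⊗[k] C) :
    TensorProduct.lid k C (LinearMap.rTensor C counit (canSwap k H C x)) =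
      rightAct k H C (TensorProduct.comm k H C x) := by
  induction x with
  | zero => simp
  | add x y hx hy => simp only [map_add, hx, hy]
  | tmul h c =>
    conv_rhs => rw [← sum_counit_smul (ℛ k c)]
    simp [canSwap_tmul, comul_eq_sum c, tmul_sum]

variable (k H C) in
/-- The map `β ⊗ V : H ⊗ (C ⊗ V) → (C ⊗ C) ⊗ V`, `h ⊗ (c ⊗ v) ↦ (c₁ ⊗ c₂ h) ⊗ v`. -/
noncomputable def canSwapTensor (V : Type*) [AddCommGroup V] [Module k V] :
    H ⊗[k] (C ⊗[k] V) →ₗ[k] (C ⊗[k] C) ⊗[k] V :=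
  LinearMap.rTensor V (canSwap k H C) ∘ₗ (TensorProduct.assoc k H C V).symm.toLinearMap

variable {V : Type*} [AddCommGroup V] [Module k V]

@[simp]
theorem canSwapTensor_tmul (h : H) (c : C) (v : V) :
    canSwapTensor k H C V (h ⊗ₜ (c ⊗ₜ v)) = canSwap k H C (h ⊗ₜ c) ⊗ₜ v := rfl

theorem canSwapTensor_injective (hβ : Function.Injective (canSwap k H C)) :
    Function.Injective (canSwapTensor k H C V) :=
  (Module.Flat.rTensor_preserves_injective_linearMap _ hβ).comp (LinearEquiv.injective _)

theorem canSwapTensor_lTensor_lTensor {W : Type*} [AddCommGroup W] [Module k W]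
    (φ : V →ₗ[k] W) (x : H ⊗[k] (C ⊗[k] V)) :
    canSwapTensor k H C W (LinearMap.lTensor H (LinearMap.lTensor C φ) x) =
      LinearMap.lTensor (C ⊗[k] C) φ (canSwapTensor k H C V x) := by
  have natural : canSwapTensor k H C W ∘ₗ LinearMap.lTensor H (LinearMap.lTensor C φ) =
      LinearMap.lTensor (C ⊗[k] C) φ ∘ₗ canSwapTensor k H C V := by
    ext; simp
  exact LinearMap.congr_fun natural x

theorem canSwapTensor_lTensor_comulSwap (x : H ⊗[k] C) :
    canSwapTensor k H C C (LinearMap.lTensor H (comulSwap k C) x) =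
      TensorProduct.comm k C (C ⊗[k] C) (TensorProduct.assoc k C C C
        (LinearMap.rTensor C comul (canSwap k H C x))) := by
  induction x with
  | zero => simp
  | add x y hx hy => simp only [map_add, hx, hy]
  | tmul h c =>
    let F : C ⊗[k] (C ⊗[k] C) →ₗ[k] (C ⊗[k] C) ⊗[k] C :=
      (TensorProduct.comm k C (C ⊗[k] C)).toLinearMap
        ∘ₗ LinearMap.lTensor C (LinearMap.lTensor C (actBy k C h))
    calc
      _ = F (LinearMap.lTensor C comul (comul c)) := by
        simp [F, canSwap_tmul, comulSwap, comul_eq_sum, tmul_sum, sum_tmul]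
      _ = F (TensorProduct.assoc k C C C (LinearMap.rTensor C comul (comul c))) := by
        rw [coassoc_apply]
      _ = _ := by simp [F, canSwap_tmul, comul_eq_sum, sum_tmul]

theorem canSwapTensor_lTensor_comulSwap_of_eq {c : C} {x : H ⊗[k] C}
    (hx : canSwap k H C x = comulSwap k C c) :
    canSwapTensor k H C C (LinearMap.lTensor H (comulSwap k C) x) =
      (TensorProduct.assoc k C C C).symm (LinearMap.lTensor C comul (comulSwap k C c)) := by
  let F : C ⊗[k] (C ⊗[k] C) →ₗ[k] (C ⊗[k] C) ⊗[k] C :=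
    (TensorProduct.comm k C (C ⊗[k] C)).toLinearMap
      ∘ₗ LinearMap.lTensor C (TensorProduct.comm k C C).toLinearMap
      ∘ₗ (TensorProduct.leftComm k C C C).toLinearMap
  rw [canSwapTensor_lTensor_comulSwap, hx]
  calc
    _ = F (LinearMap.lTensor C comul (comul c)) := by
      simp [F, comulSwap, comul_eq_sum, tmul_sum, sum_tmul]
    _ = F (TensorProduct.assoc k C C C (LinearMap.rTensor C comul (comul c))) := by
      rw [coassoc_apply]
    _ = _ := by simp [F, comulSwap, comul_eq_sum, tmul_sum, sum_tmul]

end CanSwap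

section CoinvariantPart

/-- The map `C → C`, `c ↦ c₁ g(c₂)`; for the convolution inverse `g` of a right `H`-linear map
it is constant on the classes modulo `I`. -/
noncomputable def coinvariantPart (g : C →ₗ[k] H) : C →ₗ[k] C :=
  rightAct k H C ∘ₗ LinearMap.lTensor C g ∘ₗ comul

theorem coinvariantPart_apply (g : C →ₗ[k] H) (c : C) : coinvariantPart g c =
    ∑ i ∈ (ℛ k c).index, (ℛ k c).left i <• g ((ℛ k c).right i) := by
  simp [coinvariantPart, comul_eq_sum]

theorem coinvariantPart_act_comul (hfg : IsConvInverse f g) :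
    rightAct k H C ∘ₗ TensorProduct.map (coinvariantPart g) f ∘ₗ comul = LinearMap.id := by
  ext c
  let F : C ⊗[k] (C ⊗[k] C) →ₗ[k] C :=
    rightAct k H C ∘ₗ LinearMap.lTensor C (LinearMap.mul' k H ∘ₗ TensorProduct.map g f)
  calc
    _ = F (TensorProduct.assoc k C C C (LinearMap.rTensor C comul (comul c))) := by
      simp [F, coinvariantPart_apply, comul_eq_sum, sum_tmul, mul_smul]
    _ = F (LinearMap.lTensor C comul (comul c)) := by rw [coassoc_apply]
    _ = c := by simp [F, comul_eq_sum c, hfg.inv_mul_comul, sum_counit_smul_left]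

theorem canSwap_lTensor_mulRight_comul (h : H) (c : C) :
    canSwap k H C (TensorProduct.comm k C H
        (LinearMap.lTensor C (LinearMap.mulRight k h ∘ₗ g) (comul c))) =
      LinearMap.lTensor C (actBy k C h ∘ₗ coinvariantPart g) (comul c) := by
  let F : C ⊗[k] (C ⊗[k] C) →ₗ[k] C ⊗[k] C :=
    LinearMap.lTensor C (actBy k C h ∘ₗ rightAct k H C ∘ₗ LinearMap.lTensor C g)
  calc
    _ = F (TensorProduct.assoc k C C C (LinearMap.rTensor C comul (comul c))) := by
      simp [F, canSwap_tmul, comul_eq_sum, sum_tmul, mul_smul]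
    _ = F (LinearMap.lTensor C comul (comul c)) := by rw [coassoc_apply]
    _ = LinearMap.lTensor C (actBy k C h ∘ₗ coinvariantPart g) (comul c) := by
      simp [F, comul_eq_sum c, coinvariantPart]

theorem canSwap_cleftCoaction (c : C) :
    canSwap k H C (cleftCoaction f g c) = actMiddle f (TensorProduct.assoc k C C C
      (TensorProduct.map comul (coinvariantPart g) (comul c))) := by
  calc
    _ = ∑ i ∈ (ℛ k c).index, canSwap k H C (TensorProduct.comm k C H (LinearMap.lTensor C
          (LinearMap.mulRight k (f ((ℛ k c).left i)) ∘ₗ g) (comul ((ℛ k c).right i)))) := by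
      simp [cleftCoaction, comul_eq_sum, tmul_sum]
    _ = ∑ i ∈ (ℛ k c).index, LinearMap.lTensor C
          (actBy k C (f ((ℛ k c).left i)) ∘ₗ coinvariantPart g) (comul ((ℛ k c).right i)) := by
      simp only [canSwap_lTensor_mulRight_comul]
    _ = actMiddle f (LinearMap.lTensor C (LinearMap.lTensor C (coinvariantPart g))
          (LinearMap.lTensor C comul (comul c))) := by
      simp [comul_eq_sum, tmul_sum]
    _ = _ := by
      rw [← coassoc_apply]
      simp [comul_eq_sum, sum_tmul]

end CoinvariantPart

section ModuleCoalgebra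

variable [IsModuleCoalgebra k H C]

theorem comul_act_eq_sum (c : C) (h : H) :
    comul (R := k) (c <• h) = ∑ i ∈ (ℛ k c).index, ∑ j ∈ (ℛ k h).index,
      ((ℛ k c).left i <• (ℛ k h).left j) ⊗ₜ[k] ((ℛ k c).right i <• (ℛ k h).right j) := by
  rw [IsModuleCoalgebra.comul_act, comul_eq_sum c, comul_eq_sum h, sum_tmul]
  simp [tmul_sum]

variable (k H C) in
/-- The action `C ⊗ H → C` as a coalgebra homomorphism. -/
noncomputable def rightActHom : C ⊗[k] H →ₗc[k] C where
  toLinearMap := rightAct k H C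
  counit_comp := by ext; simp [IsModuleCoalgebra.counit_act, mul_comm]
  map_comp_comul := by
    ext c h
    exact (IsModuleCoalgebra.comul_act c h).symm

/-- Both `c ⊗ h ↦ S(h) g(c)` and `c ⊗ h ↦ g(c h)` are convolution inverse to
`c ⊗ h ↦ f(c h) = f(c) h`. -/
theorem IsConvInverse.inv_map_act (hf : ∀ (c : C) (h : H), f (c <• h) = f c * h)
    (hfg : IsConvInverse f g) (c : C) (h : H) : g (c <• h) = antipode k h * g c := by
  let a : C ⊗[k] H →ₗc[k] C := rightActHom k H C
  let Sg : C ⊗[k] H →ₗ[k] H :=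
    LinearMap.mul' k H ∘ₗ TensorProduct.map (antipode k) g
      ∘ₗ (TensorProduct.comm k C H).toLinearMap
  have left_inv : toConv Sg * toConv (f ∘ₗ a.toLinearMap) = 1 := by
    ext c h
    calc
      _ = ∑ j ∈ (ℛ k h).index, ∑ i ∈ (ℛ k c).index, antipode k ((ℛ k h).left j) *
          g ((ℛ k c).left i) * (f ((ℛ k c).right i) * (ℛ k h).right j) := by
        simp [comul_tmul, comul_eq_sum c, comul_eq_sum h, sum_tmul, tmul_sum, Sg, a, rightActHom,
          hf]
      _ = ∑ j ∈ (ℛ k h).index, antipode k ((ℛ k h).left j) *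
          LinearMap.mul' k H (TensorProduct.map g f (comul c)) * (ℛ k h).right j := by
        simp [comul_eq_sum c, Finset.mul_sum, Finset.sum_mul, mul_assoc]
      _ = _ := by
        simp [hfg.inv_mul_comul, Algebra.algebraMap_eq_smul_one, ← Finset.smul_sum,
          HopfAlgebra.sum_antipode_mul_eq_smul, smul_smul, mul_comm]
  have right_inv : toConv (f ∘ₗ a.toLinearMap) * toConv (g ∘ₗ a.toLinearMap) = 1 := by
    rw [← WithConv.ofConv_injective.eq_iff,
      ← LinearMap.convMul_comp_coalgHom_distrib (toConv f) (toConv g), hfg.1]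
    ext c h
    simp [a]
  exact congr($((left_inv_eq_right_inv left_inv right_inv).symm) (c ⊗ₜ h))

theorem lTensor_proj_comul_act (c : C) (h : H) :
    LinearMap.lTensor C (proj k H C) (comul (R := k) (c <• h)) =
      LinearMap.rTensor _ (actBy k C h) (LinearMap.lTensor C (proj k H C) (comul (R := k) c)) := by
  conv_rhs => rw [← sum_counit_smul_left (ℛ k h)]
  simp [comul_act_eq_sum, comul_eq_sum c, proj_act, tmul_smul, smul_tmul', Finset.sum_smul,
    ← sum_tmul, -Submodule.mkQ_apply]

theorem lTensor_proj_comulSwap_act (c : C) (h : H) :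
    LinearMap.lTensor C (proj k H C) (comulSwap k C (c <• h)) =
      LinearMap.rTensor _ (actBy k C h) (LinearMap.lTensor C (proj k H C) (comulSwap k C c)) := by
  conv_rhs => rw [← sum_counit_smul (ℛ k h)]
  simp [comulSwap, comul_act_eq_sum, comul_eq_sum c, proj_act, tmul_smul, smul_tmul',
    Finset.sum_smul, ← sum_tmul, -Submodule.mkQ_apply]

variable (k H C) in
/-- `C^D` as an `H`-submodule of `C`. -/
noncomputable def center : Submodule Hᵐᵒᵖ C where
  __ := (coextensionCenter k H C).toAddSubmonoid
  smul_mem' h c hc := mem_coextensionCenter_iff.2 <| by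
    change LinearMap.lTensor C (proj k H C) (comul (R := k) (c <• h.unop)) =
      LinearMap.lTensor C (proj k H C) (comulSwap k C (c <• h.unop))
    rw [lTensor_proj_comul_act, lTensor_proj_comulSwap_act, mem_coextensionCenter_iff.1 hc]

theorem mem_center {c : C} : c ∈ center k H C ↔
    LinearMap.lTensor C (proj k H C) (comul (R := k) c) =
      LinearMap.lTensor C (proj k H C) (comulSwap k C c) :=
  mem_coextensionCenter_iff

variable (k H C) in
/-- The inclusion `C^D → C`, as a `k`-linear map. -/
noncomputable abbrev centerIncl : center k H C →ₗ[k] C :=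
  (center k H C).subtype.restrictScalars k

theorem coinvariantPart_act (hg : ∀ (c : C) (h : H), g (c <• h) = antipode k h * g c)
    (c : C) (h : H) : coinvariantPart g (c <• h) = counit (R := k) h • coinvariantPart g c := by
  calc
    coinvariantPart g (c <• h) = ∑ i ∈ (ℛ k c).index, ((ℛ k c).left i <•
        ∑ j ∈ (ℛ k h).index, (ℛ k h).left j * antipode k ((ℛ k h).right j)) <•
          g ((ℛ k c).right i) := by
      simp [coinvariantPart, comul_act_eq_sum, hg, mul_smul, Finset.sum_smul, Finset.smul_sum]
    _ = counit (R := k) h • coinvariantPart g c := by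
      simp [HopfAlgebra.sum_mul_antipode_eq_smul, coinvariantPart_apply, Finset.smul_sum,
        smul_comm _ (counit (R := k) h)]

/-- The map `D → C`, `π(c) ↦ c₁ g(c₂)`. -/
noncomputable def coinvariantSection
    (hg : ∀ (c : C) (h : H), g (c <• h) = antipode k h * g c) : base k H C →ₗ[k] C :=
  (coideal k H C).liftQ (coinvariantPart g) <| by
    rw [coideal, Submodule.span_le]
    rintro _ ⟨c, h, rfl⟩
    simp [coinvariantPart_act hg]

@[simp]
theorem coinvariantSection_proj (hg : ∀ (c : C) (h : H), g (c <• h) = antipode k h * g c) (c : C) :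
    coinvariantSection hg (proj k H C c) = coinvariantPart g c := rfl

theorem canSwap_cleftCoaction_of_mem_center (hf : ∀ (c : C) (h : H), f (c <• h) = f c * h)
    (hfg : IsConvInverse f g) {c : C} (hc : c ∈ center k H C) :
    canSwap k H C (cleftCoaction f g c) = comulSwap k C c := by
  let Φ : C ⊗[k] base k H C →ₗ[k] C ⊗[k] C := actMiddle f
    ∘ₗ (TensorProduct.assoc k C C C).toLinearMap
    ∘ₗ TensorProduct.map comul (coinvariantSection (hfg.inv_map_act hf))
  let Ψ : (C ⊗[k] C) ⊗[k] C →ₗ[k] C ⊗[k] C := (TensorProduct.comm k C C).toLinearMap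
    ∘ₗ LinearMap.rTensor C (rightAct k H C ∘ₗ TensorProduct.map (coinvariantPart g) f)
  calc
    _ = Φ (LinearMap.lTensor C (proj k H C) (comul (R := k) c)) := by
      simp [canSwap_cleftCoaction, Φ, comul_eq_sum c, -Submodule.mkQ_apply]
    _ = Φ (LinearMap.lTensor C (proj k H C) (comulSwap k C c)) := by rw [mem_center.1 hc]
    _ = Ψ ((TensorProduct.assoc k C C C).symm (LinearMap.lTensor C comul (comul c))) := by
      simp [Φ, Ψ, comulSwap, comul_eq_sum, -Submodule.mkQ_apply, sum_tmul, tmul_sum]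
    _ = Ψ (LinearMap.rTensor C comul (comul c)) := by rw [coassoc_symm_apply]
    _ = TensorProduct.comm k C C (LinearMap.rTensor C (rightAct k H C
          ∘ₗ TensorProduct.map (coinvariantPart g) f ∘ₗ comul) (comul c)) := by
      simp [Ψ, LinearMap.rTensor_comp]
    _ = comulSwap k C c := by simp [coinvariantPart_act_comul hfg, comulSwap]

theorem rid_lTensor_counit_canSwap (x : H ⊗[k] C) :
    TensorProduct.rid k C (LinearMap.lTensor C counit (canSwap k H C x)) =
      TensorProduct.lid k C (LinearMap.rTensor C counit x) := by
  induction x with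
  | zero => simp
  | add x y hx hy => simp only [map_add, hx, hy]
  | tmul h c =>
    simp [canSwap_tmul, comul_eq_sum c, IsModuleCoalgebra.counit_act,
      mul_comm _ (counit (R := k) h), mul_smul, ← Finset.smul_sum, sum_counit_smul_left]

theorem canSwapTensor_lTensor_proj_comul (x : H ⊗[k] C) :
    canSwapTensor k H C _ (LinearMap.lTensor H (LinearMap.lTensor C (proj k H C) ∘ₗ comul) x) =
      (TensorProduct.assoc k C C (base k H C)).symm
        (LinearMap.lTensor C (LinearMap.lTensor C (proj k H C) ∘ₗ comul) (canSwap k H C x)) := by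
  induction x with
  | zero => simp
  | add x y hx hy => simp only [map_add, hx, hy]
  | tmul h c =>
    let F : (C ⊗[k] C) ⊗[k] C →ₗ[k] (C ⊗[k] C) ⊗[k] base k H C :=
      TensorProduct.map (LinearMap.lTensor C (actBy k C h)) (proj k H C)
    calc
      _ = F (LinearMap.rTensor C comul (comul c)) := by
        simp [F, canSwap_tmul, comul_eq_sum, tmul_sum, sum_tmul]
      _ = F ((TensorProduct.assoc k C C C).symm (LinearMap.lTensor C comul (comul c))) := by
        rw [coassoc_symm_apply]
      _ = (TensorProduct.assoc k C C (base k H C)).symm (LinearMap.lTensor C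
            (LinearMap.rTensor _ (actBy k C h) ∘ₗ LinearMap.lTensor C (proj k H C) ∘ₗ comul)
            (comul c)) := by
        simp [F, comul_eq_sum, tmul_sum]
      _ = _ := by simp [canSwap_tmul, comul_eq_sum c, lTensor_proj_comul_act]

theorem canSwapTensor_lTensor_canSwap_comul (x : H ⊗[k] C) :
    canSwapTensor k H C C (LinearMap.lTensor H (canSwap k H C)
        (TensorProduct.assoc k H H C (LinearMap.rTensor C comul x))) =
      (TensorProduct.assoc k C C C).symm (LinearMap.lTensor C comul (canSwap k H C x)) := by
  induction x with
  | zero => simp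
  | add x y hx hy => simp only [map_add, hx, hy]
  | tmul h c =>
    let F : (C ⊗[k] C) ⊗[k] C →ₗ[k] (C ⊗[k] C) ⊗[k] C := ∑ j ∈ (ℛ k h).index,
      TensorProduct.map (LinearMap.lTensor C (actBy k C ((ℛ k h).left j)))
        (actBy k C ((ℛ k h).right j))
    calc
      _ = F (LinearMap.rTensor C comul (comul c)) := by
        simp [F, canSwap_tmul, comul_eq_sum, tmul_sum, sum_tmul,
          Finset.sum_comm (s := (ℛ k h).index)]
      _ = F ((TensorProduct.assoc k C C C).symm (LinearMap.lTensor C comul (comul c))) := by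
        rw [coassoc_symm_apply]
      _ = _ := by
        simp [F, canSwap_tmul, ↓comul_act_eq_sum, comul_eq_sum, tmul_sum]

/-- `C^D` is the kernel of `c ↦ c₁ ⊗ π(c₂) - c₂ ⊗ π(c₁)`, and `H ⊗ -` preserves kernels. -/
theorem mem_range_lTensor_centerIncl (hβ : Function.Injective (canSwap k H C)) {c : C}
    {x : H ⊗[k] C} (hx : canSwap k H C x = comulSwap k C c) :
    x ∈ LinearMap.range (LinearMap.lTensor H (centerIncl k H C)) := by
  let δ : C →ₗ[k] C ⊗[k] base k H C := LinearMap.lTensor C (proj k H C) ∘ₗ comul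
  let δ' : C →ₗ[k] C ⊗[k] base k H C := LinearMap.lTensor C (proj k H C) ∘ₗ comulSwap k C
  have exact_centerIncl : Function.Exact (centerIncl k H C) (δ - δ') := by
    intro c
    rw [LinearMap.sub_apply, sub_eq_zero]
    simpa [δ, δ'] using mem_center.symm
  have agree : canSwapTensor k H C _ (LinearMap.lTensor H δ x) =
      canSwapTensor k H C _ (LinearMap.lTensor H δ' x) := by
    calc
      _ = (TensorProduct.assoc k C C (base k H C)).symm
          (LinearMap.lTensor C δ (comulSwap k C c)) := by
        rw [canSwapTensor_lTensor_proj_comul, hx]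
      _ = LinearMap.lTensor (C ⊗[k] C) (proj k H C)
          ((TensorProduct.assoc k C C C).symm (LinearMap.lTensor C comul (comulSwap k C c))) := by
        simp [δ, comulSwap, comul_eq_sum, tmul_sum]
      _ = _ := by
        rw [← canSwapTensor_lTensor_comulSwap_of_eq hx, ← canSwapTensor_lTensor_lTensor,
          LinearMap.lTensor_comp_apply]
  refine (Module.Flat.lTensor_exact H exact_centerIncl x).1 ?_
  rw [LinearMap.lTensor_sub, LinearMap.sub_apply, canSwapTensor_injective hβ agree, sub_self]

theorem cleftCoaction_act (hf : ∀ (c : C) (h : H), f (c <• h) = f c * h)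
    (hg : ∀ (c : C) (h : H), g (c <• h) = antipode k h * g c) (c : C) (h : H) :
    cleftCoaction f g (c <• h) = aydTwist k H C
      (cleftCoaction f g c ⊗ₜ LinearMap.lTensor H comul (comul (R := k) h)) := by
  let c' i := ℛ k ((ℛ k c).right i)
  let h' j := ℛ k ((ℛ k h).right j)
  let term i j i' j' : H ⊗[k] C :=
    (antipode k ((h' j).right j') * (g ((c' i).right i') * (f ((ℛ k c).left i) * (ℛ k h).left j)))
      ⊗ₜ[k] ((c' i).left i' <• (h' j).left j')
  calc
    _ = ∑ i ∈ (ℛ k c).index, ∑ j ∈ (ℛ k h).index, ∑ i' ∈ (c' i).index, ∑ j' ∈ (h' j).index,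
          term i j i' j' := by
      simp [cleftCoaction, ↓comul_act_eq_sum, tmul_sum, hf, hg, mul_assoc, term, c', h']
    _ = ∑ j ∈ (ℛ k h).index, ∑ j' ∈ (h' j).index, ∑ i ∈ (ℛ k c).index, ∑ i' ∈ (c' i).index,
          term i j i' j' := by
      rw [Finset.sum_comm]
      refine Finset.sum_congr rfl fun j _ => ?_
      simp only [Finset.sum_comm (s := (h' j).index)]
    _ = _ := by
      simp [cleftCoaction, comul_eq_sum, tmul_sum, sum_tmul, mul_assoc, term, c', h']

theorem lTensor_centerIncl_injective :
    Function.Injective (LinearMap.lTensor H (centerIncl k H C)) :=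
  Module.Flat.lTensor_preserves_injective_linearMap _ Subtype.val_injective

/-- The coaction `ρ(c) = g(c₃) f(c₁) ⊗ c₂` of `C^D`. -/
noncomputable def centerCoaction (hf : ∀ (c : C) (h : H), f (c <• h) = f c * h)
    (hfg : IsConvInverse f g) : center k H C →ₗ[k] H ⊗[k] center k H C :=
  LinearMap.codRestrictOfInjective (cleftCoaction f g ∘ₗ centerIncl k H C)
    (LinearMap.lTensor H (centerIncl k H C)) lTensor_centerIncl_injective fun m =>
      mem_range_lTensor_centerIncl (canSwap_injective hf hfg)
        (canSwap_cleftCoaction_of_mem_center hf hfg m.2)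

section CenterCoaction

variable (hf : ∀ (c : C) (h : H), f (c <• h) = f c * h) (hfg : IsConvInverse f g)
  (m : center k H C)

theorem lTensor_centerCoaction :
    LinearMap.lTensor H (centerIncl k H C) (centerCoaction hf hfg m) = cleftCoaction f g (m : C) :=
  LinearMap.codRestrictOfInjective_comp_apply ..

theorem canSwap_lTensor_centerCoaction :
    canSwap k H C (LinearMap.lTensor H (centerIncl k H C) (centerCoaction hf hfg m)) =
      comulSwap k C (m : C) := by
  rw [lTensor_centerCoaction, canSwap_cleftCoaction_of_mem_center hf hfg m.2]

theorem centerCoaction_coassoc :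
    TensorProduct.assoc k H H _ (LinearMap.rTensor _ comul (centerCoaction hf hfg m)) =
      LinearMap.lTensor H (centerCoaction hf hfg) (centerCoaction hf hfg m) := by
  have hβ : Function.Injective (canSwap k H C) := canSwap_injective hf hfg
  apply Module.Flat.lTensor_preserves_injective_linearMap _
    (lTensor_centerIncl_injective (k := k) (H := H) (C := C))
  apply Module.Flat.lTensor_preserves_injective_linearMap _ hβ
  apply canSwapTensor_injective hβ
  have assoc_natural (x : H ⊗[k] center k H C) :
      LinearMap.lTensor H (LinearMap.lTensor H (centerIncl k H C))
        (TensorProduct.assoc k H H _ (LinearMap.rTensor _ comul x)) =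
      TensorProduct.assoc k H H C
        (LinearMap.rTensor C comul (LinearMap.lTensor H (centerIncl k H C) x)) := by
    induction x with
    | zero => simp
    | add x y hx hy => simp only [map_add, hx, hy]
    | tmul h m => simp [comul_eq_sum, sum_tmul]
  have coaction_comulSwap : canSwap k H C ∘ₗ LinearMap.lTensor H (centerIncl k H C)
      ∘ₗ centerCoaction hf hfg = comulSwap k C ∘ₗ centerIncl k H C :=
    LinearMap.ext (canSwap_lTensor_centerCoaction hf hfg)
  calc
    _ = (TensorProduct.assoc k C C C).symm (LinearMap.lTensor C comul (comulSwap k C (m : C))) := by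
      rw [assoc_natural, canSwapTensor_lTensor_canSwap_comul, canSwap_lTensor_centerCoaction]
    _ = canSwapTensor k H C C (LinearMap.lTensor H (comulSwap k C)
          (LinearMap.lTensor H (centerIncl k H C) (centerCoaction hf hfg m))) :=
      (canSwapTensor_lTensor_comulSwap_of_eq (canSwap_lTensor_centerCoaction hf hfg m)).symm
    _ = _ := by
      simp only [← LinearMap.lTensor_comp_apply, coaction_comulSwap]

theorem centerCoaction_counit :
    TensorProduct.lid k _ (LinearMap.rTensor _ counit (centerCoaction hf hfg m)) = m := by
  have lid_natural (x : H ⊗[k] center k H C) :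
      centerIncl k H C (TensorProduct.lid k _ (LinearMap.rTensor _ counit x)) =
      TensorProduct.lid k C
        (LinearMap.rTensor C counit (LinearMap.lTensor H (centerIncl k H C) x)) := by
    induction x with
    | zero => simp
    | add x y hx hy => simp only [map_add, hx, hy]
    | tmul h m => simp
  refine Subtype.val_injective ((lid_natural _).trans ?_)
  rw [← rid_lTensor_counit_canSwap, canSwap_lTensor_centerCoaction]
  simp [comulSwap, comul_eq_sum, sum_counit_smul]

theorem centerCoaction_act (h : H) :
    centerCoaction hf hfg (m <• h) = aydTwist k H _
      (centerCoaction hf hfg m ⊗ₜ LinearMap.lTensor H comul (comul (R := k) h)) := by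
  have aydTwist_natural (x : H ⊗[k] center k H C) (y : H ⊗[k] (H ⊗[k] H)) :
      LinearMap.lTensor H (centerIncl k H C) (aydTwist k H (center k H C) (x ⊗ₜ y)) =
        aydTwist k H C (LinearMap.lTensor H (centerIncl k H C) x ⊗ₜ y) := by
    have : LinearMap.lTensor H (centerIncl k H C) ∘ₗ aydTwist k H (center k H C) =
        aydTwist k H C ∘ₗ LinearMap.rTensor _ (LinearMap.lTensor H (centerIncl k H C)) := by
      ext; simp
    exact LinearMap.congr_fun this (x ⊗ₜ y)
  apply lTensor_centerIncl_injective
  rw [aydTwist_natural, lTensor_centerCoaction, lTensor_centerCoaction]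
  exact cleftCoaction_act hf (hfg.inv_map_act hf) m h

theorem rightAct_centerCoaction :
    rightAct k H _ (TensorProduct.comm k H _ (centerCoaction hf hfg m)) = m := by
  have rightAct_natural (x : H ⊗[k] center k H C) :
      centerIncl k H C (rightAct k H _ (TensorProduct.comm k H _ x)) =
      rightAct k H C (TensorProduct.comm k H C (LinearMap.lTensor H (centerIncl k H C) x)) := by
    induction x with
    | zero => simp
    | add x y hx hy => simp only [map_add, hx, hy]
    | tmul h m => simp
  refine Subtype.val_injective ((rightAct_natural _).trans ?_)
  rw [← lid_rTensor_counit_canSwap, canSwap_lTensor_centerCoaction]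
  simp [comulSwap, comul_eq_sum, sum_counit_smul_left]

theorem isRightLeftSAYD_centerCoaction : IsRightLeftSAYD (centerCoaction hf hfg) where
  coassoc := LinearMap.ext (centerCoaction_coassoc hf hfg)
  counit_coact := centerCoaction_counit hf hfg
  antiYetterDrinfeld := centerCoaction_act hf hfg
  stable := rightAct_centerCoaction hf hfg

end CenterCoaction

end ModuleCoalgebra

end HopfCoextension

theorem proposition3p28_general {k H C : Type*} [Field k] [Ring H] [HopfAlgebra k H]
    [AddCommGroup C] [Module k C] [Coalgebra k C]
    [Module Hᵐᵒᵖ C] [IsScalarTower k Hᵐᵒᵖ C] [HopfCoextension.IsModuleCoalgebra k H C]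
    (f fInv : C →ₗ[k] H) (hf : ∀ (c : C) (h : H), f (c <• h) = f c * h)
    (hfInv : HopfCoextension.IsConvInverse f fInv) :
    ∃ M : Submodule Hᵐᵒᵖ C,
      M.restrictScalars k = HopfCoextension.coextensionCenter k H C ∧
      ∃ ρ : M →ₗ[k] H ⊗[k] M,
        (∀ c : M, LinearMap.lTensor H (M.subtype.restrictScalars k) (ρ c) =
          HopfCoextension.cleftCoaction f fInv (c : C)) ∧
        HopfCoextension.IsRightLeftSAYD ρ :=
  ⟨HopfCoextension.center k H C, rfl, HopfCoextension.centerCoaction hf hfInv,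
    HopfCoextension.lTensor_centerCoaction hf hfInv,
    HopfCoextension.isRightLeftSAYD_centerCoaction hf hfInv⟩

theorem proposition3p28 {k H C : Type*} [Field k] [Ring H] [HopfAlgebra k H]
    [AddCommGroup C] [Module k C] [Coalgebra k C]
    [Module Hᵐᵒᵖ C] [IsScalarTower k Hᵐᵒᵖ C] [HopfCoextension.IsModuleCoalgebra k H C]
    (hGalois : HopfCoextension.IsHopfGalois k H C)
    (f fInv : C →ₗ[k] H) (hf : HopfCoextension.IsTotalCointegral f)
    (hfInv : HopfCoextension.IsConvInverse f fInv) :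
    ∃ M : Submodule Hᵐᵒᵖ C,
      M.restrictScalars k = HopfCoextension.coextensionCenter k H C ∧
      ∃ ρ : M →ₗ[k] H ⊗[k] M,
        (∀ c : M, LinearMap.lTensor H (M.subtype.restrictScalars k) (ρ c) =
          HopfCoextension.cleftCoaction f fInv (c : C)) ∧
        HopfCoextension.IsRightLeftSAYD ρ :=
  proposition3p28_general f fInv hf.map_act hfInv
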